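/- Call a simple pentagon in the Euclidean plane (not assumed convex; interior angles equal to $180^\circ$ are allowed) *efficient* if it encloses area $1$ and its perimeter is at most $2\sqrt{2+\sqrt{3}}\approx 3.8637$, the perimeter of a unit-area Cairo pentagon (a pentagon circumscribed about a circle with three angles of $120^\circ$ and two non-adjacent right angles). Then every interior angle $a$ of an efficient pentagon satisfies $$80.91^\circ < a < 142.29^\circ .$$ -/

import Mathlib

open scoped Real Topology

namespace Polygon

/-- A polygon in the Euclidean plane is simple if consecutive vertices are distinct, two
consecutive edges meet only at their common vertex, and any two other distinct edges are
disjoint. Angles equal to `π` are allowed. (Meaningful for `n ≥ 3`.) -/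
def IsSimple {n : ℕ} (p : Polygon (EuclideanSpace ℝ (Fin 2)) n) : Prop :=
  p.HasNondegenerateEdges ∧
  (∀ i, p.edgeSet ℝ i ∩ p.edgeSet ℝ (finRotate n i) = {p (finRotate n i)}) ∧
  (∀ i j, i ≠ j → j ≠ finRotate n i → i ≠ finRotate n j →
    Disjoint (p.edgeSet ℝ i) (p.edgeSet ℝ j))

/-- The perimeter of a polygon: the sum of the lengths of its edges. -/
noncomputable def perimeter {n : ℕ} (p : Polygon (EuclideanSpace ℝ (Fin 2)) n) : ℝ :=
  ∑ i, dist (p i) (p (finRotate n i))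

/-- The open region enclosed by a polygon: the union of the bounded connected components of
the complement of its boundary curve. -/
def enclosedRegion {n : ℕ} (p : Polygon (EuclideanSpace ℝ (Fin 2)) n) :
    Set (EuclideanSpace ℝ (Fin 2)) :=
  {x | x ∈ (p.boundary ℝ)ᶜ ∧ Bornology.IsBounded (connectedComponentIn (p.boundary ℝ)ᶜ x)}

/-- The area of a polygon: the Lebesgue measure of the region it encloses. -/
noncomputable def area {n : ℕ} (p : Polygon (EuclideanSpace ℝ (Fin 2)) n) : ENNReal :=
  MeasureTheory.volume p.enclosedRegion

open Classical in
/-- The interior angle, in radians and in `(0, 2π)`, of a simple polygon at its `i`-th vertex.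
Let `α ∈ (0, π]` be the unoriented angle between the two edges at the vertex. The open segment
from the vertex to the midpoint of the two neighbouring vertices runs inside the sector of
opening `α`. If its points close to the vertex are enclosed by the polygon, the interior angle
is `α`; otherwise it is the angle `2π - α` of the complementary sector. (For a straight angle,
`α = π`, both values are `π`.) -/
noncomputable def interiorAngle {n : ℕ} (p : Polygon (EuclideanSpace ℝ (Fin 2)) n)
    (i : Fin n) : ℝ :=
  if ∀ᶠ t : ℝ in 𝓝[>] 0,
      AffineMap.lineMap (p i) (midpoint ℝ (p ((finRotate n).symm i)) (p (finRotate n i))) t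
        ∈ p.enclosedRegion then
    EuclideanGeometry.angle (p ((finRotate n).symm i)) (p i) (p (finRotate n i))
  else
    2 * π - EuclideanGeometry.angle (p ((finRotate n).symm i)) (p i) (p (finRotate n i))

/-- An efficient pentagon: a simple pentagon, not assumed convex, of unit area whose perimeter is
at most `2 √(2 + √3)`, the perimeter of the unit-area Cairo pentagon. -/
structure IsEfficient (p : Polygon (EuclideanSpace ℝ (Fin 2)) 5) : Prop where
  isSimple : p.IsSimple
  area_eq_one : p.area = 1
  perimeter_le : p.perimeter ≤ 2 * √(2 + √3)

end Polygon

/-!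
An efficient pentagon has perimeter less than `4`. By the isoperimetric inequality for
quadrilaterals no vertex lies in the convex hull of the other four, since the hull of those four
would have area less than `1`; hence the pentagon is strictly convex. For a convex pentagon of
area `A` and perimeter `P` with exterior angles `τ i`, Lhuilier's inequality
`4 * A * ∑ i, tan (τ i / 2) ≤ P ^ 2` bounds the sum of the tangents by `2 + √3`. The half
exterior angles have sum `π` and the tangent is convex, so if one of them is too far from `π / 5`,
then the sum of the tangents is larger than `2 + √3`.
-/

namespace Pentagon

open MeasureTheory Set Module Bornology NormedSpace
open InnerProductGeometry (angle angle_neg_left angle_normalize_left angle_normalize_right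
  sin_angle_mul_norm_mul_norm inner_eq_cos_angle_of_norm_eq_one
  angle_eq_angle_add_add_angle_add_of_mem_span)
open EuclideanGeometry (angle_add_angle_add_angle_eq_pi angle_comm)
open scoped RealInnerProductSpace EuclideanGeometry NNReal

attribute [local instance] FiniteDimensional.of_fact_finrank_eq_two

section Orient

variable {E : Type*} [NormedAddCommGroup E] [InnerProductSpace ℝ E] [Fact (finrank ℝ E = 2)]
  (o : Orientation ℝ E (Fin 2))

local notation "ω" => o.areaForm

theorem nonempty_orientation : Nonempty (Orientation ℝ E (Fin 2)) :=
  ⟨((stdOrthonormalBasis ℝ E).reindex (finCongr Fact.out)).toBasis.orientation⟩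

theorem areaForm_smul_add_smul_add_smul (x y z : E) :
    ω y z • x + ω z x • y + ω x y • z = 0 := by
  rcases eq_or_ne x 0 with rfl | hx
  · simp
  set v := ω y z • x + ω z x • y + ω x y • z with hv
  have inner_eq_zero : ⟪x, v⟫ = 0 := by
    simp only [hv, inner_add_right, real_inner_smul_right, real_inner_self_eq_norm_sq,
      o.areaForm_swap z x]
    linear_combination -o.inner_mul_areaForm_sub x y z
  have areaForm_eq_zero : ω x v = 0 := by
    simp only [hv, map_add, map_smul, o.areaForm_apply_self, o.areaForm_swap z x, smul_eq_mul]
    ring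
  have norm_sq_eq_zero : ‖v‖ ^ 2 = 0 := by
    simpa [inner_eq_zero, areaForm_eq_zero, hx, eq_comm] using o.inner_sq_add_areaForm_sq x v
  simpa using norm_sq_eq_zero

/-- The affine function `c ↦ ω (b - a, c - a)`: twice the signed area of the triangle `a b c`,
positive exactly when `c` lies to the left of the directed line `a b`. -/
noncomputable def orient (a b : E) : E →ᵃ[ℝ] ℝ :=
  (ω (b - a)).toAffineMap - AffineMap.const ℝ E (ω (b - a) a)

theorem orient_apply (a b c : E) : orient o a b c = ω (b - a) (c - a) := by
  simp only [orient, AffineMap.coe_sub, Pi.sub_apply, LinearMap.coe_toAffineMap,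
    AffineMap.const_apply, map_sub]

theorem orient_expand (a b c : E) : orient o a b c = ω a b + ω b c + ω c a := by
  simp only [orient_apply, map_sub, LinearMap.sub_apply, o.areaForm_apply_self,
    o.areaForm_swap b a, o.areaForm_swap c a]
  ring

theorem orient_eq_areaForm_sub_sub (a b x : E) : orient o a b x = ω (a - x) (b - x) := by
  simp only [orient_expand, map_sub, LinearMap.sub_apply, o.areaForm_apply_self,
    o.areaForm_swap x a, o.areaForm_swap x b]
  ring

theorem orient_rotate (a b c : E) : orient o b c a = orient o a b c := by
  simp only [orient_expand]; ring

theorem orient_swap (a b c : E) : orient o a c b = -orient o a b c := by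
  simp only [orient_expand, o.areaForm_swap a c, o.areaForm_swap c b, o.areaForm_swap b a]; ring

theorem orient_swap_left (a b c : E) : orient o b a c = -orient o a b c := by
  rw [← orient_rotate, orient_swap, orient_rotate]

@[simp] theorem orient_self_right (a b : E) : orient o a b b = 0 := by
  rw [orient_apply, o.areaForm_apply_self]

@[simp] theorem orient_self_outer (a b : E) : orient o a b a = 0 := by simp [orient_apply]

theorem orient_neg (a b c : E) : orient (-o) a b c = -orient o a b c := by
  simp [orient_apply, o.areaForm_neg_orientation]

theorem orient_add_orient_add_orient (a b c x : E) :
    orient o b c x + orient o c a x + orient o a b x = orient o a b c := by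
  simp only [orient_expand, o.areaForm_swap x a, o.areaForm_swap x b, o.areaForm_swap x c]; ring

theorem orient_mul_orient_nonneg {a b c x : E} (hx : x ∈ convexHull ℝ {a, b, c}) :
    0 ≤ orient o b c a * orient o b c x := by
  have convex_side : Convex ℝ {x | 0 ≤ orient o b c a * orient o b c x} :=
    (convex_Ici 0).affine_preimage (orient o b c a • orient o b c)
  refine convexHull_min ?_ convex_side hx
  rintro _ (rfl | rfl | rfl) <;> simp [mul_self_nonneg]

theorem orient_add_sub (b c x : E) : orient o b c (b + c - x) = -orient o b c x := by
  simp only [orient_expand, map_add, map_sub, LinearMap.add_apply, LinearMap.sub_apply,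
    o.areaForm_apply_self, o.areaForm_swap c b]
  ring

theorem continuous_orient (a b : E) : Continuous (orient o a b) :=
  AffineMap.continuous_of_finiteDimensional _

theorem orient_smul_add_orient_smul_add_orient_smul (a b c x : E) :
    orient o b c x • a + orient o c a x • b + orient o a b x • c = orient o a b c • x := by
  have relation := areaForm_smul_add_smul_add_smul o (a - x) (b - x) (c - x)
  simp only [← orient_eq_areaForm_sub_sub, smul_sub] at relation
  rw [← orient_add_orient_add_orient o a b c x, add_smul, add_smul, ← sub_eq_zero, ← relation]
  abel

theorem mem_triangle {a b c x : E} (habc : 0 < orient o a b c) (ha : 0 ≤ orient o b c x)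
    (hb : 0 ≤ orient o c a x) (hc : 0 ≤ orient o a b x) : x ∈ convexHull ℝ {a, b, c} := by
  have sum_mem := Finset.univ.centerMass_mem_convexHull (s := {a, b, c}) (R := ℝ)
    (w := ![orient o b c x, orient o c a x, orient o a b x]) (z := ![a, b, c])
    (by simp [Fin.forall_fin_succ, ha, hb, hc])
    (by simpa [Fin.sum_univ_three, orient_add_orient_add_orient] using habc)
    (by simp [Fin.forall_fin_succ])
  simpa [Finset.centerMass, Fin.sum_univ_three, orient_add_orient_add_orient,
    orient_smul_add_orient_smul_add_orient_smul, smul_smul, habc.ne'] using sum_mem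

theorem exists_smul_eq_of_areaForm_eq_zero {u v : E} (hu : u ≠ 0) (h : ω u v = 0) :
    ∃ t : ℝ, t • u = v := by
  have relation := areaForm_smul_add_smul_add_smul o u v (o.rightAngleRotation u)
  simp only [h, o.areaForm_rightAngleRotation_right, o.areaForm_rightAngleRotation_left, zero_smul,
    add_zero, neg_smul, ← sub_eq_add_neg, sub_eq_zero] at relation
  refine ⟨⟪u, u⟫⁻¹ * ⟪v, u⟫, ?_⟩
  rw [mul_smul, relation, inv_smul_smul₀ (inner_self_ne_zero.mpr hu)]

theorem exists_lineMap_eq_of_orient_eq_zero {a b x : E} (hab : a ≠ b) (h : orient o a b x = 0) :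
    ∃ t : ℝ, AffineMap.lineMap a b t = x := by
  rw [orient_apply] at h
  obtain ⟨t, ht⟩ := exists_smul_eq_of_areaForm_eq_zero o (sub_ne_zero.mpr hab.symm) h
  exact ⟨t, by simp [AffineMap.lineMap_apply, ht]⟩

theorem collinear_of_orient_eq_zero {a b x : E} (h : orient o a b x = 0) :
    Collinear ℝ {a, b, x} := by
  rcases eq_or_ne a b with rfl | hab
  · simpa using collinear_pair ℝ a x
  obtain ⟨t, rfl⟩ := exists_lineMap_eq_of_orient_eq_zero o hab h
  convert! collinear_insert_of_mem_affineSpan_pair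
    (AffineMap.lineMap_mem_affineSpan_pair t a b) using 1
  grind

theorem orient_mul_orient_pos {a b c d : E} (ha : a ∉ convexHull ℝ {b, c, d})
    (hb : b ∉ convexHull ℝ {a, c, d}) (hdisj : Disjoint (segment ℝ a b) (segment ℝ c d)) :
    0 < orient o a b c * orient o a b d := by
  by_contra! not_pos
  obtain ⟨x, hx_mem, hx⟩ : (0 : ℝ) ∈ orient o a b '' segment ℝ c d := by
    rw [image_segment, segment_eq_uIcc, mem_uIcc]
    rcases mul_nonpos_iff.mp not_pos with h | h
    · exact Or.inr h.symm
    · exact Or.inl h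
  have segment_subset (y : E) : segment ℝ c d ⊆ convexHull ℝ {y, c, d} :=
    (convexHull_pair c d).symm.subset.trans (convexHull_mono (subset_insert _ _))
  have segment_subset' (y : E) : segment ℝ x y ⊆ convexHull ℝ {y, c, d} :=
    (convex_convexHull ℝ _).segment_subset (segment_subset y hx_mem)
      (subset_convexHull ℝ _ (mem_insert y _))
  rcases (collinear_of_orient_eq_zero o hx).wbtw_or_wbtw_or_wbtw with h | h | h
  · exact hb (segment_subset' a (mem_segment_iff_wbtw.mpr h.symm))
  · exact hdisj.notMem_of_mem_right hx_mem (mem_segment_iff_wbtw.mpr h.symm)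
  · exact ha (segment_subset' b (mem_segment_iff_wbtw.mpr h))

end Orient

section ConvexHull

variable {ι E : Type*} [Fintype ι] [AddCommGroup E] [Module ℝ E] {f : ι → E}

theorem convexHull_range_eq_image_stdSimplex (f : ι → E) :
    convexHull ℝ (range f) = Fintype.linearCombination ℝ f '' stdSimplex ℝ ι := by
  classical
  rw [← convexHull_rangle_single_eq_stdSimplex, LinearMap.image_convexHull, ← range_comp]
  congr 2 with i
  simp

theorem exists_pos_of_sum_eq_zero {g : ι → ℝ} (hg : g ≠ 0) (hsum : ∑ i, g i = 0) :
    ∃ i, 0 < g i := by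
  contrapose! hg
  exact funext fun i ↦
    (Finset.sum_eq_zero_iff_of_nonpos fun i _ ↦ hg i).mp hsum i (Finset.mem_univ i)

/-- Subtract from a convex combination the largest multiple of the affine dependency `g` that
keeps all weights nonnegative. -/
theorem exists_mem_convexHull_image_compl {g : ι → ℝ} (hg : g ≠ 0) (hsum : ∑ i, g i = 0)
    (hcomb : ∑ i, g i • f i = 0) {x : E} (hx : x ∈ convexHull ℝ (range f)) :
    ∃ i, 0 < g i ∧ x ∈ convexHull ℝ (f '' {i}ᶜ) := by
  classical
  rw [convexHull_range_eq_image_stdSimplex] at hx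
  obtain ⟨w, ⟨w_nonneg, w_sum⟩, rfl⟩ := hx
  obtain ⟨i₀, hi₀⟩ := exists_pos_of_sum_eq_zero hg hsum
  obtain ⟨i, hi, ratio_le⟩ := Finset.exists_min_image {i | 0 < g i} (fun i ↦ w i / g i)
    ⟨i₀, by simpa using hi₀⟩
  replace hi : 0 < g i := by simpa using hi
  refine ⟨i, hi, ?_⟩
  set v : ι → ℝ := fun j ↦ w j - w i / g i * g j
  have v_self : v i = 0 := by simp [v, hi.ne']
  have v_nonneg (j) : 0 ≤ v j := by
    rcases le_or_gt (g j) 0 with h | h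
    · exact sub_nonneg.mpr <| (mul_nonpos_of_nonneg_of_nonpos
        (div_nonneg (w_nonneg i) hi.le) h).trans (w_nonneg j)
    · exact sub_nonneg.mpr <| (le_div_iff₀ h).mp <| ratio_le j (by simpa using h)
  have v_sum : ∑ j, v j = 1 := by
    simp only [v, Finset.sum_sub_distrib, ← Finset.mul_sum, hsum, w_sum, mul_zero, sub_zero]
  have v_comb : Fintype.linearCombination ℝ f w = ∑ j, v j • f j := by
    simp only [v, sub_smul, mul_smul, Finset.sum_sub_distrib, ← Finset.smul_sum, hcomb, smul_zero,
      sub_zero, Fintype.linearCombination_apply]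
  rw [v_comb, ← Finset.sum_erase (f := fun j ↦ v j • f j) (a := i) _ (by simp [v_self])]
  refine (convex_convexHull ℝ _).sum_mem (fun j _ ↦ v_nonneg j) ?_ fun j hj ↦
    subset_convexHull ℝ _ ⟨j, by simpa using hj, rfl⟩
  rw [Finset.sum_erase _ v_self, v_sum]

theorem exists_affine_dependency [FiniteDimensional ℝ E]
    (h : finrank ℝ E + 1 < Fintype.card ι) (f : ι → E) :
    ∃ g : ι → ℝ, g ≠ 0 ∧ ∑ i, g i = 0 ∧ ∑ i, g i • f i = 0 := by
  have not_linearIndependent : ¬ LinearIndependent ℝ fun i ↦ (f i, (1 : ℝ)) := fun hli ↦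
    h.not_ge <| by simpa using hli.fintype_card_le_finrank
  obtain ⟨g, comb_eq_zero, i, hi⟩ := Fintype.not_linearIndependent_iff.mp not_linearIndependent
  simp only [Prod.smul_mk, smul_eq_mul, mul_one, Prod.ext_iff, Prod.fst_sum, Prod.snd_sum,
    Prod.fst_zero, Prod.snd_zero] at comb_eq_zero
  exact ⟨g, fun h ↦ hi (congrFun h i), comb_eq_zero.symm⟩

theorem exists_ne_mem_convexHull_image_compl [FiniteDimensional ℝ E]
    (h : finrank ℝ E + 1 < Fintype.card ι) {x : E} (hx : x ∈ convexHull ℝ (range f)) :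
    ∃ i j, i ≠ j ∧ x ∈ convexHull ℝ (f '' {i}ᶜ) ∧ x ∈ convexHull ℝ (f '' {j}ᶜ) := by
  obtain ⟨g, hg, hsum, hcomb⟩ := exists_affine_dependency h f
  obtain ⟨i, hi, hxi⟩ := exists_mem_convexHull_image_compl hg hsum hcomb hx
  obtain ⟨j, hj, hxj⟩ := exists_mem_convexHull_image_compl (g := -g) (neg_ne_zero.mpr hg)
    (by simp [hsum]) (by simp [hcomb]) hx
  refine ⟨i, j, ?_, hxi, hxj⟩
  rintro rfl
  exact hi.not_gt (neg_pos.mp hj)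

end ConvexHull

theorem two_mul_measure_le_sum {ι α : Type*} [Fintype ι] [MeasurableSpace α] (μ : Measure α)
    {s : Set α} {t : ι → Set α} (ht : ∀ i, MeasurableSet (t i))
    (h : ∀ x ∈ s, ∃ i j, i ≠ j ∧ x ∈ t i ∧ x ∈ t j) : 2 * μ s ≤ ∑ i, μ (t i) := by
  classical
  calc 2 * μ s ≤ 2 * μ {x | 2 ≤ ∑ i, (t i).indicator (1 : α → ENNReal) x} := by
        gcongr
        intro x hx
        obtain ⟨i, j, hij, hi, hj⟩ := h x hx
        calc (2 : ENNReal) = ∑ k ∈ {i, j}, (t k).indicator (1 : α → ENNReal) x := by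
              simp [Finset.sum_pair hij, hi, hj, one_add_one_eq_two]
          _ ≤ ∑ k, (t k).indicator (1 : α → ENNReal) x :=
              Finset.sum_le_sum_of_subset (Finset.subset_univ _)
    _ ≤ ∫⁻ x, ∑ i, (t i).indicator (1 : α → ENNReal) x ∂μ :=
        mul_meas_ge_le_lintegral
          (Finset.measurable_sum _ fun i _ ↦ measurable_one.indicator (ht i)) 2
    _ = ∑ i, μ (t i) := by
        rw [lintegral_finsetSum _ fun i _ ↦ measurable_one.indicator (ht i)]
        exact Finset.sum_congr rfl fun i _ ↦ lintegral_indicator_one (ht i)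

theorem two_mul_measure_convexHull_range_le {ι E : Type*} [Fintype ι] [NormedAddCommGroup E]
    [NormedSpace ℝ E] [FiniteDimensional ℝ E] [MeasurableSpace E] [BorelSpace E]
    (μ : Measure E) (h : finrank ℝ E + 1 < Fintype.card ι) (f : ι → E) :
    2 * μ (convexHull ℝ (range f)) ≤ ∑ i, μ (convexHull ℝ (f '' {i}ᶜ)) :=
  two_mul_measure_le_sum μ
    (fun i ↦ ((toFinite (f '' {i}ᶜ)).isCompact_convexHull (𝕜 := ℝ)).measurableSet)
    fun _ hx ↦ exists_ne_mem_convexHull_image_compl h hx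

section Triangle

theorem measure_affineMap_eq_zero {E : Type*} [NormedAddCommGroup E] [NormedSpace ℝ E]
    [MeasurableSpace E] [BorelSpace E] [FiniteDimensional ℝ E] (μ : Measure E)
    [μ.IsAddHaarMeasure] {f : E →ᵃ[ℝ] ℝ} {a : E} (ha : f a ≠ 0) : μ {x | f x = 0} = 0 := by
  have coe_zeros : {x | f x = 0} = ((affineSpan ℝ {(0 : ℝ)}).comap f : Set E) := by
    ext x; simp [AffineSubspace.coe_affineSpan_singleton]
  rw [coe_zeros]
  refine Measure.addHaar_affineSubspace μ _ fun eq_top ↦ ha ?_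
  have : a ∈ (affineSpan ℝ {(0 : ℝ)}).comap f := eq_top ▸ AffineSubspace.mem_top ℝ E a
  simpa using this

variable {E : Type*} [NormedAddCommGroup E] [InnerProductSpace ℝ E] [Fact (finrank ℝ E = 2)]
  [MeasurableSpace E] [BorelSpace E] (o : Orientation ℝ E (Fin 2))

theorem volume_parallelepiped (u v : E) :
    volume (parallelepiped ![u, v]) = ENNReal.ofReal |o.areaForm u v| := by
  rw [← o.measure_eq_volume, AlternatingMap.measure_parallelepiped, o.areaForm_to_volumeForm]

theorem volume_parallelogram_le (a b c : E) :
    volume (convexHull ℝ {a, b, c, b + c - a}) ≤ ENNReal.ofReal |orient o a b c| := by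
  calc volume (convexHull ℝ {a, b, c, b + c - a})
      ≤ volume ((fun x ↦ -a + x) ⁻¹' parallelepiped ![b - a, c - a]) := by
        refine measure_mono (convexHull_min ?_
          ((convex_parallelepiped _).translate_preimage_right (-a)))
        have mem_of_coords (s t : ℝ) (hs : s ∈ Icc 0 1) (ht : t ∈ Icc 0 1) :
            s • (b - a) + t • (c - a) ∈ parallelepiped ![b - a, c - a] :=
          (mem_parallelepiped_iff _ _).mpr
            ⟨![s, t], by simp_all [Pi.le_def, Fin.forall_fin_two], by simp [Fin.sum_univ_two]⟩
        rintro _ (rfl | rfl | rfl | rfl)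
        · simpa using mem_of_coords 0 0 (by simp) (by simp)
        · simpa [neg_add_eq_sub] using mem_of_coords 1 0 (by simp) (by simp)
        · simpa [neg_add_eq_sub] using mem_of_coords 0 1 (by simp) (by simp)
        · have : -a + (b + c - a) = (1 : ℝ) • (b - a) + (1 : ℝ) • (c - a) := by module
          exact mem_preimage.mpr (this ▸ mem_of_coords 1 1 (by simp) (by simp))
    _ = ENNReal.ofReal |orient o a b c| := by
        rw [measure_preimage_add, volume_parallelepiped o, orient_apply]

/-- The triangle and its reflection in the midpoint of `b c` overlap in a segment only and
together lie in a parallelogram. -/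
theorem volume_triangle_le (a b c : E) :
    volume (convexHull ℝ {a, b, c}) ≤ ENNReal.ofReal (|orient o a b c| / 2) := by
  set T := convexHull ℝ {a, b, c}
  set P := convexHull ℝ {a, b, c, b + c - a}
  have T_subset : T ⊆ P := convexHull_mono (by grind)
  rcases eq_or_ne (orient o a b c) 0 with degenerate | nondegenerate
  · simpa [degenerate] using (measure_mono T_subset).trans (volume_parallelogram_le o a b c)
  set T' := (fun x ↦ b + c - x) ⁻¹' T
  have T'_subset : T' ⊆ P := by
    have T_subset_preimage : T ⊆ (fun x ↦ b + c - x) ⁻¹' P := by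
      refine convexHull_min ?_
        ((convex_convexHull ℝ _).affine_preimage (AffineEquiv.constVSub ℝ (b + c)).toAffineMap)
      rintro _ (rfl | rfl | rfl) <;> exact subset_convexHull ℝ _ (by simp)
    intro x hx
    simpa using T_subset_preimage hx
  have measurableSet_T : NullMeasurableSet T :=
    ((toFinite _).isCompact_convexHull (𝕜 := ℝ)).measurableSet.nullMeasurableSet
  have volume_T' : volume T' = volume T :=
    (Measure.measurePreserving_sub_left volume (b + c)).measure_preimage measurableSet_T
  have overlap : AEDisjoint volume T T' := by
    refine measure_mono_null ?_ (measure_affineMap_eq_zero volume (f := orient o b c) (a := a)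
      (by rwa [orient_rotate]))
    rintro x ⟨hx, hx'⟩
    have h₁ := orient_mul_orient_nonneg o hx
    have h₂ := orient_mul_orient_nonneg o hx'
    rw [orient_add_sub, mul_neg, neg_nonneg] at h₂
    simpa [orient_rotate, nondegenerate] using h₂.antisymm h₁
  have two_mul_volume_le : 2 * volume T ≤ ENNReal.ofReal |orient o a b c| := calc
    2 * volume T = volume (T ∪ T') := by
      rw [measure_union₀' measurableSet_T overlap, volume_T', two_mul]
    _ ≤ volume P := measure_mono (union_subset T_subset T'_subset)
    _ ≤ _ := volume_parallelogram_le o a b c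
  rw [ENNReal.ofReal_div_of_pos two_pos, ENNReal.ofReal_ofNat]
  rwa [ENNReal.le_div_iff_mul_le (by simp) (by simp), mul_comm]

theorem volume_triangle_le_dist (a b c : E) :
    volume (convexHull ℝ {a, b, c}) ≤ ENNReal.ofReal (dist a b * dist b c / 2) := by
  obtain ⟨o⟩ := nonempty_orientation (E := E)
  refine (volume_triangle_le o a b c).trans (ENNReal.ofReal_le_ofReal ?_)
  gcongr
  rw [orient_rotate o c a b, orient_eq_areaForm_sub_sub, dist_eq_norm, dist_comm b c, dist_eq_norm,
    mul_comm]
  exact o.abs_areaForm_le _ _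

/-- The hull is covered twice by the triangles with three of the four points as vertices, and the
area of each of these is at most half the product of two sides. -/
theorem volume_convexHull_range_four_le (f : Fin 4 → E) :
    volume (convexHull ℝ (range f)) ≤ ENNReal.ofReal ((∑ i, dist (f i) (f (i + 1))) ^ 2 / 16) := by
  have triangle_le (i : Fin 4) : volume (convexHull ℝ (f '' {i}ᶜ)) ≤
      ENNReal.ofReal (dist (f (i + 1)) (f (i + 2)) * dist (f (i + 2)) (f (i + 3)) / 2) := by
    have compl_eq : ({i}ᶜ : Set (Fin 4)) = {i + 1, i + 2, i + 3} := by
      ext j; revert i j; simp only [mem_compl_iff, mem_insert_iff, mem_singleton_iff]; decide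
    rw [compl_eq, image_insert_eq, image_pair]
    exact volume_triangle_le_dist _ _ _
  have two_mul_le := (two_mul_measure_convexHull_range_le volume
    (by simp [(Fact.out : finrank ℝ E = 2)]) f).trans (Finset.sum_le_sum fun i _ ↦ triangle_le i)
  rw [← ENNReal.ofReal_sum_of_nonneg (fun _ _ ↦ by positivity)] at two_mul_le
  rw [← ENNReal.mul_le_mul_iff_right (a := 2) (by simp) (by simp)]
  refine two_mul_le.trans ?_
  rw [← ENNReal.ofReal_ofNat, ← ENNReal.ofReal_mul (by simp)]
  refine ENNReal.ofReal_le_ofReal ?_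
  simp only [Fin.sum_univ_four, Fin.reduceAdd]
  nlinarith [sq_nonneg
    (dist (f 0) (f 1) + dist (f 2) (f 3) - (dist (f 1) (f 2) + dist (f 3) (f 0)))]

end Triangle

section ConvexPolygon

variable {E : Type*} [NormedAddCommGroup E] [InnerProductSpace ℝ E] [Fact (finrank ℝ E = 2)]
  (o : Orientation ℝ E (Fin 2))

/-- The closed polygon with vertices `p 0, …, p (n - 1)` is strictly convex and positively
oriented: the vertices off an edge lie strictly to the left of it. Indices are modulo `n`. -/
def IsConvexPolygon {n : ℕ} [NeZero n] (p : Fin n → E) : Prop :=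
  ∀ i k, k ≠ i → k ≠ i + 1 → 0 < orient o (p i) (p (i + 1)) (p k)

theorem orient_mul_orient_pos_of_notMem_convexHull {ι : Type*} {p : ι → E}
    (hp : ∀ i, p i ∉ convexHull ℝ (p '' {i}ᶜ)) {i j k l : ι} (hij : i ≠ j) (hik : i ≠ k)
    (hil : i ≠ l) (hjk : j ≠ k) (hjl : j ≠ l)
    (hdisj : Disjoint (segment ℝ (p i) (p j)) (segment ℝ (p k) (p l))) :
    0 < orient o (p i) (p j) (p k) * orient o (p i) (p j) (p l) := by
  have notMem {a b c d : ι} (hb : a ≠ b) (hc : a ≠ c) (hd : a ≠ d) :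
      p a ∉ convexHull ℝ {p b, p c, p d} := fun h ↦ hp a <| convexHull_mono (by
    rintro _ (rfl | rfl | rfl) <;> exact mem_image_of_mem p (by simpa using Ne.symm ‹_›)) h
  exact orient_mul_orient_pos o (notMem hij hik hil) (notMem hij.symm hjk hjl) hdisj

theorem exists_isConvexPolygon {p : Fin 5 → E} (hp : ∀ i, p i ∉ convexHull ℝ (p '' {i}ᶜ))
    (hdisj : ∀ i, Disjoint (segment ℝ (p i) (p (i + 1))) (segment ℝ (p (i + 2)) (p (i + 3)))) :
    ∃ o : Orientation ℝ E (Fin 2), IsConvexPolygon o p := by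
  have next_same_side (o : Orientation ℝ E (Fin 2)) (i : Fin 5) :
      0 < orient o (p i) (p (i + 1)) (p (i + 2)) * orient o (p i) (p (i + 1)) (p (i + 3)) :=
    orient_mul_orient_pos_of_notMem_convexHull o hp (by omega) (by omega) (by omega) (by omega)
      (by omega) (hdisj i)
  have previous_same_side (o : Orientation ℝ E (Fin 2)) (i : Fin 5) :
      0 < orient o (p (i + 2)) (p (i + 3)) (p i) *
        orient o (p (i + 2)) (p (i + 3)) (p (i + 1)) :=
    orient_mul_orient_pos_of_notMem_convexHull o hp (by omega) (by omega) (by omega) (by omega)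
      (by omega) (hdisj i).symm
  obtain ⟨o, orient_zero⟩ : ∃ o : Orientation ℝ E (Fin 2), 0 < orient o (p 0) (p 1) (p 2) := by
    obtain ⟨o⟩ := nonempty_orientation (E := E)
    rcases (left_ne_zero_of_mul (next_same_side o 0).ne').lt_or_gt with h | h
    · exact ⟨-o, by simpa [orient_neg] using h⟩
    · exact ⟨o, h⟩
  have orient_succ (i : Fin 5) (h : 0 < orient o (p i) (p (i + 1)) (p (i + 2))) :
      0 < orient o (p (i + 1)) (p (i + 2)) (p (i + 3)) := by
    have hprev := previous_same_side o (i - 1)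
    have hnext := next_same_side o (i + 1)
    simp only [show i - 1 + 2 = i + 1 by omega, show i - 1 + 3 = i + 2 by omega, sub_add_cancel,
      orient_rotate o (p i)] at hprev
    simp only [add_assoc, Fin.reduceAdd] at hnext
    rw [show i + 4 = i - 1 by omega] at hnext
    exact pos_of_mul_pos_left hnext (pos_of_mul_pos_left hprev h.le).le
  have orient_pos (i : Fin 5) : 0 < orient o (p i) (p (i + 1)) (p (i + 2)) := by
    have h₁ := orient_succ 0 orient_zero
    have h₂ := orient_succ 1 h₁
    have h₃ := orient_succ 2 h₂
    have h₄ := orient_succ 3 h₃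
    fin_cases i <;> assumption
  refine ⟨o, fun i k hk hk' ↦ ?_⟩
  obtain rfl | rfl | rfl : k = i + 2 ∨ k = i + 3 ∨ k = i - 1 := by omega
  · exact orient_pos i
  · exact pos_of_mul_pos_right (next_same_side o i) (orient_pos i).le
  · have h := orient_pos (i - 1)
    rwa [sub_add_cancel, show i - 1 + 2 = i + 1 by omega, ← orient_rotate] at h

variable {n : ℕ} [NeZero n] {p : Fin n → E}

variable {o} in
theorem IsConvexPolygon.orient_nonneg (hp : IsConvexPolygon o p) (i k : Fin n) :
    0 ≤ orient o (p i) (p (i + 1)) (p k) := by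
  rcases eq_or_ne k i with rfl | hk
  · simp
  rcases eq_or_ne k (i + 1) with rfl | hk'
  · simp
  exact (hp i k hk hk').le

variable {o} in
theorem IsConvexPolygon.orient_nonneg_of_mem_convexHull (hp : IsConvexPolygon o p) {x : E}
    (hx : x ∈ convexHull ℝ (range p)) (i : Fin n) : 0 ≤ orient o (p i) (p (i + 1)) x := by
  have convex_side : Convex ℝ {y | 0 ≤ orient o (p i) (p (i + 1)) y} :=
    (convex_Ici 0).affine_preimage (orient o (p i) (p (i + 1)))
  refine convexHull_min ?_ convex_side hx
  rintro _ ⟨k, rfl⟩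
  exact hp.orient_nonneg i k

variable {o} in
theorem IsConvexPolygon.exists_mem_fan_triangle (hp : IsConvexPolygon o p) (hn : 2 < n) {x : E}
    (hx : ∀ i, 0 ≤ orient o (p i) (p (i + 1)) x) :
    ∃ i, x ∈ convexHull ℝ {p 0, p i, p (i + 1)} := by
  obtain ⟨m, rfl⟩ : ∃ m, n = m + 3 := ⟨n - 3, by omega⟩
  obtain ⟨i, ⟨i_ne, succ_ne, hi⟩, i_max⟩ := Set.Finite.exists_maximal
    (toFinite {i : Fin (m + 3) | i ≠ 0 ∧ i + 1 ≠ 0 ∧ 0 ≤ orient o (p 0) (p i) x})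
    ⟨1, by simp, by simp [Fin.ext_iff, Fin.val_add, Nat.mod_eq_of_lt], by simpa using hx 0⟩
  have i_lt : i < i + 1 := Fin.lt_add_one_iff.mpr <| Fin.lt_last_iff_ne_last.mpr <| by
    rintro rfl; simp at succ_ne
  have orient_succ_nonpos : orient o (p 0) (p (i + 1)) x ≤ 0 := by
    by_contra! pos
    rcases eq_or_ne (i + 1 + 1) 0 with h | h
    · have := hx (i + 1)
      rw [h, orient_swap_left] at this
      linarith
    · exact (i_max ⟨succ_ne, h, pos.le⟩ i_lt.le).not_gt i_lt
  refine ⟨i, mem_triangle o ?_ (hx i) ?_ hi⟩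
  · rw [← orient_rotate]; exact hp i 0 i_ne.symm succ_ne.symm
  · rw [orient_swap_left]; linarith

/-- The area enclosed by the closed polygon `p`, by the shoelace formula; it is positive if `p`
runs counterclockwise. -/
noncomputable def signedArea (p : Fin n → E) : ℝ := (∑ i, o.areaForm (p i) (p (i + 1))) / 2

theorem sum_orient_eq (p : Fin n → E) (q : E) :
    ∑ i, orient o q (p i) (p (i + 1)) = 2 * signedArea o p := by
  have shift : ∑ i, o.areaForm q (p (i + 1)) = ∑ i, o.areaForm q (p i) :=
    Equiv.sum_comp (Equiv.addRight 1) fun i ↦ o.areaForm q (p i)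
  simp only [orient_expand, o.areaForm_swap _ q, Finset.sum_add_distrib, Finset.sum_neg_distrib,
    shift, signedArea]
  ring

variable {o} in
theorem IsConvexPolygon.volume_convexHull_le [MeasurableSpace E] [BorelSpace E]
    (hp : IsConvexPolygon o p) (hn : 2 < n) :
    volume (convexHull ℝ (range p)) ≤ ENNReal.ofReal (signedArea o p) := by
  have orient_nonneg (i : Fin n) : 0 ≤ orient o (p 0) (p i) (p (i + 1)) := by
    rw [← orient_rotate]; exact hp.orient_nonneg i 0
  calc volume (convexHull ℝ (range p))
      ≤ volume (⋃ i, convexHull ℝ {p 0, p i, p (i + 1)}) := measure_mono fun x hx ↦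
        mem_iUnion.mpr (hp.exists_mem_fan_triangle hn (hp.orient_nonneg_of_mem_convexHull hx))
    _ ≤ ∑ i, volume (convexHull ℝ {p 0, p i, p (i + 1)}) := measure_iUnion_fintype_le _ _
    _ ≤ ∑ i, ENNReal.ofReal (|orient o (p 0) (p i) (p (i + 1))| / 2) :=
        Finset.sum_le_sum fun i _ ↦ volume_triangle_le o _ _ _
    _ = ENNReal.ofReal (signedArea o p) := by
        rw [← ENNReal.ofReal_sum_of_nonneg fun _ _ ↦ by positivity, ← Finset.sum_div]
        simp only [abs_of_nonneg (orient_nonneg _), sum_orient_eq]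
        ring_nf

end ConvexPolygon

section Components

theorem connectedComponentIn_compl_subset {X : Type*} [TopologicalSpace X] {U B : Set X} {x : X}
    (hU : IsOpen U) (hUB : frontier U ⊆ B) (hx : x ∈ U) : connectedComponentIn Bᶜ x ⊆ U := by
  by_cases hxB : x ∈ Bᶜ
  · refine isPreconnected_connectedComponentIn.subset_of_closure_inter_subset hU
      ⟨x, mem_connectedComponentIn hxB, hx⟩ ?_
    rintro y ⟨hy_closure, hy_component⟩
    by_contra hyU
    exact connectedComponentIn_subset _ _ hy_component
      (hUB (hU.frontier_eq ▸ ⟨hy_closure, hyU⟩))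
  · simp [connectedComponentIn_eq_empty hxB]

theorem not_isBounded_connectedComponentIn_compl {V : Type*} [NormedAddCommGroup V]
    [NormedSpace ℝ V] {B K : Set V} {x : V} (hK : Convex ℝ K) (hK' : K.Nonempty) (hBK : B ⊆ K)
    (hx : x ∉ K) : ¬ IsBounded (connectedComponentIn Bᶜ x) := by
  obtain ⟨y, hy⟩ := hK'
  have x_ne_y : x ≠ y := by rintro rfl; exact hx hy
  let ray (t : ℝ) : V := AffineMap.lineMap y x t
  have ray_preconnected : IsPreconnected (ray '' Ici 1) :=
    isPreconnected_Ici.image ray (AffineMap.lineMap_continuous.continuousOn)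
  have ray_subset : ray '' Ici 1 ⊆ Bᶜ := by
    rintro _ ⟨t, ht : 1 ≤ t, rfl⟩ hray
    refine hx (hK.segment_subset hy (hBK hray) (mem_segment_iff_wbtw.mpr ?_))
    refine ⟨t⁻¹, ⟨by positivity, inv_le_one_of_one_le₀ ht⟩, ?_⟩
    simp [ray, AffineMap.lineMap_apply, smul_smul, inv_mul_cancel₀ (by positivity : t ≠ 0)]
  have ray_subset_component : ray '' Ici 1 ⊆ connectedComponentIn Bᶜ x :=
    ray_preconnected.subset_connectedComponentIn ⟨1, self_mem_Ici, by simp [ray]⟩ ray_subset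
  intro bounded
  obtain ⟨r, hr⟩ := (bounded.subset ray_subset_component).subset_closedBall y
  obtain ⟨t, ht, hrt⟩ : ∃ t : ℝ, 1 ≤ t ∧ r < t * dist y x :=
    ((Filter.eventually_ge_atTop 1).and
      ((Filter.tendsto_id.atTop_mul_const (dist_pos.mpr x_ne_y.symm)).eventually_gt_atTop r)).exists
  have dist_le := hr (mem_image_of_mem ray ht)
  rw [Metric.mem_closedBall, dist_lineMap_left, Real.norm_of_nonneg (by positivity)] at dist_le
  linarith

end Components

section ConvexRegion

variable {E : Type*} [NormedAddCommGroup E] [InnerProductSpace ℝ E] [Fact (finrank ℝ E = 2)]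
  {o : Orientation ℝ E (Fin 2)} {n : ℕ} [NeZero n] {p : Fin n → E}

theorem add_one_ne_self (hn : 2 < n) (i : Fin n) : i + 1 ≠ i := by
  obtain ⟨m, rfl⟩ : ∃ m, n = m + 3 := ⟨n - 3, by omega⟩
  simp

theorem add_one_ne_sub_one (hn : 2 < n) (i : Fin n) : i + 1 ≠ i - 1 := by
  obtain ⟨m, rfl⟩ : ∃ m, n = m + 3 := ⟨n - 3, by omega⟩
  rw [Ne, ← sub_eq_zero, show i + 1 - (i - 1) = 1 + 1 by abel]
  simp [Fin.ext_iff, Fin.val_add, Nat.mod_eq_of_lt]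

theorem sub_one_ne_self (hn : 2 < n) (i : Fin n) : i - 1 ≠ i := by
  simpa using (add_one_ne_self hn (i - 1)).symm

theorem IsConvexPolygon.orient_previous_pos (hp : IsConvexPolygon o p) (hn : 2 < n) (i : Fin n) :
    0 < orient o (p (i - 1)) (p i) (p (i + 1)) := by
  have h := hp (i - 1) (i + 1) (add_one_ne_sub_one hn i)
  rw [sub_add_cancel] at h
  exact h (add_one_ne_self hn i)

theorem IsConvexPolygon.mem_segment_of_orient_eq_zero (hp : IsConvexPolygon o p) (hn : 2 < n)
    {x : E} (hx : ∀ i, 0 ≤ orient o (p i) (p (i + 1)) x) {i : Fin n}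
    (hi : orient o (p i) (p (i + 1)) x = 0) : x ∈ segment ℝ (p i) (p (i + 1)) := by
  have previous_pos := hp.orient_previous_pos hn i
  have next_pos := hp.orient_previous_pos hn (i + 1)
  rw [add_sub_cancel_right, ← orient_rotate] at next_pos
  have hne : p i ≠ p (i + 1) := by
    intro h; simp [h] at next_pos
  obtain ⟨t, rfl⟩ := exists_lineMap_eq_of_orient_eq_zero o hne hi
  have hprevious := hx (i - 1)
  have hnext := hx (i + 1)
  simp only [sub_add_cancel, AffineMap.apply_lineMap, AffineMap.lineMap_apply_ring,
    orient_self_right, orient_self_outer, mul_zero, zero_add, add_zero] at hprevious hnext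
  exact mem_segment_iff_wbtw.mpr ⟨t, ⟨nonneg_of_mul_nonneg_left hprevious previous_pos,
    by linarith [nonneg_of_mul_nonneg_left hnext next_pos]⟩, rfl⟩

variable (o p) in
/-- The points strictly to the left of all the edges of `p`; if `p` is convex, this is the interior
of the polygon. -/
def innerRegion : Set E := {x | ∀ i, 0 < orient o (p i) (p (i + 1)) x}

theorem isOpen_innerRegion : IsOpen (innerRegion o p) := by
  rw [innerRegion, ofPred_forall]
  exact isOpen_iInter_of_finite fun i ↦ isOpen_Ioi.preimage (continuous_orient o _ _)

theorem IsConvexPolygon.frontier_innerRegion_subset (hp : IsConvexPolygon o p) (hn : 2 < n) :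
    frontier (innerRegion o p) ⊆ ⋃ i, segment ℝ (p i) (p (i + 1)) := by
  have closure_subset : closure (innerRegion o p) ⊆ {x | ∀ i, 0 ≤ orient o (p i) (p (i + 1)) x} :=
    closure_minimal (fun x hx i ↦ (hx i).le) <| by
      rw [ofPred_forall]
      exact isClosed_iInter fun i ↦ isClosed_Ici.preimage (continuous_orient o _ _)
  rw [isOpen_innerRegion.frontier_eq]
  rintro x ⟨hx_closure, hx⟩
  have hx_nonneg := closure_subset hx_closure
  obtain ⟨i, hi⟩ : ∃ i, orient o (p i) (p (i + 1)) x ≤ 0 := by simpa [innerRegion] using hx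
  exact mem_iUnion.mpr
    ⟨i, hp.mem_segment_of_orient_eq_zero hn hx_nonneg (hi.antisymm (hx_nonneg i))⟩

theorem disjoint_innerRegion_segment (i : Fin n) :
    Disjoint (innerRegion o p) (segment ℝ (p i) (p (i + 1))) := by
  refine disjoint_left.mpr fun x hx hx' ↦ (hx i).ne' ?_
  obtain ⟨t, -, rfl⟩ := mem_segment_iff_wbtw.mp hx'
  simp [AffineMap.apply_lineMap]

theorem IsConvexPolygon.isBounded_innerRegion (hp : IsConvexPolygon o p) (hn : 2 < n) :
    IsBounded (innerRegion o p) := by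
  refine (isBounded_convexHull.mpr (finite_range p).isBounded).subset fun x hx ↦ ?_
  obtain ⟨i, hi⟩ := hp.exists_mem_fan_triangle hn fun i ↦ (hx i).le
  exact convexHull_mono (by rintro _ (rfl | rfl | rfl) <;> exact mem_range_self _) hi

theorem IsConvexPolygon.lineMap_midpoint_mem_innerRegion (hp : IsConvexPolygon o p) (hn : 2 < n)
    (i : Fin n) {t : ℝ} (ht : t ∈ Ioo 0 1) :
    AffineMap.lineMap (p i) (midpoint ℝ (p (i - 1)) (p (i + 1))) t ∈ innerRegion o p := by
  intro k
  have h := hp.orient_nonneg k i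
  have hprevious := hp.orient_nonneg k (i - 1)
  have hnext := hp.orient_nonneg k (i + 1)
  have strict : 0 < orient o (p k) (p (k + 1)) (p i) ∨
      0 < orient o (p k) (p (k + 1)) (p (i - 1)) ∨
      0 < orient o (p k) (p (k + 1)) (p (i + 1)) := by
    rcases eq_or_ne k i with rfl | hk
    · exact .inr <| .inl <| hp k _ (sub_one_ne_self hn k) (add_one_ne_sub_one hn k).symm
    rcases eq_or_ne (k + 1) i with rfl | hk'
    · exact .inr <| .inr <| hp k _ (by simpa using add_one_ne_sub_one hn (k + 1))
        (add_one_ne_self hn (k + 1))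
    · exact .inl <| hp k i hk.symm hk'.symm
  obtain ⟨ht₀, ht₁⟩ := ht
  rw [AffineMap.apply_lineMap, AffineMap.map_midpoint, AffineMap.lineMap_apply_ring,
    midpoint_eq_smul_add, smul_eq_mul, invOf_eq_inv]
  have := sub_pos.mpr ht₁
  rcases strict with h | h | h <;> positivity

end ConvexRegion

section TurningAngle

variable {E : Type*} [NormedAddCommGroup E] [InnerProductSpace ℝ E] {n : ℕ} [NeZero n]

/-- The direction of the `i`-th edge of the polygon `p`. -/
noncomputable def edgeDir (p : Fin n → E) (i : Fin n) : E := normalize (p (i + 1) - p i)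

theorem dist_smul_edgeDir (p : Fin n → E) (i : Fin n) :
    dist (p i) (p (i + 1)) • edgeDir p i = p (i + 1) - p i := by
  rw [dist_eq_norm', edgeDir, norm_smul_normalize]

theorem norm_edgeDir {p : Fin n → E} {i : Fin n} (hp : p i ≠ p (i + 1)) : ‖edgeDir p i‖ = 1 :=
  norm_normalize_eq_one_iff.mpr (sub_ne_zero.mpr hp.symm)

theorem dist_eq_inner_sub_inner {p : Fin n → E} {i : Fin n} (hp : p i ≠ p (i + 1)) (q : E) :
    dist (p i) (p (i + 1)) = ⟪p (i + 1) - q, edgeDir p i⟫ - ⟪p i - q, edgeDir p i⟫ := by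
  rw [← inner_sub_left, sub_sub_sub_cancel_right, ← dist_smul_edgeDir, real_inner_smul_left,
    real_inner_self_eq_norm_sq, norm_edgeDir hp, one_pow, mul_one]

/-- The exterior angle of the polygon `p` at the vertex `p (i + 1)`, where its `i`-th and next edge
meet. -/
noncomputable def turningAngle (p : Fin n → E) (i : Fin n) : ℝ :=
  angle (edgeDir p i) (edgeDir p (i + 1))

theorem angle_eq_pi_sub_turningAngle (p : Fin n → E) (i : Fin n) :
    ∠ (p i) (p (i + 1)) (p (i + 1 + 1)) = π - turningAngle p i := by
  rw [turningAngle, edgeDir, edgeDir, angle_normalize_left, angle_normalize_right,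
    ← angle_neg_left, neg_sub, EuclideanGeometry.angle, vsub_eq_sub, vsub_eq_sub]

variable [Fact (finrank ℝ E = 2)] {o : Orientation ℝ E (Fin 2)} {p : Fin n → E}

local notation "ω" => o.areaForm

variable (o) in
theorem sin_angle_mul_norm_mul_norm_eq_abs_areaForm (x y : E) :
    Real.sin (angle x y) * (‖x‖ * ‖y‖) = |ω x y| := by
  rw [sin_angle_mul_norm_mul_norm, ← Real.sqrt_sq_eq_abs, real_inner_self_eq_norm_sq,
    real_inner_self_eq_norm_sq, ← o.inner_sq_add_areaForm_sq x y]
  ring_nf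

theorem angle_add_angle_of_orient_pos {a b c d : E} (hbd : 0 < orient o a b d)
    (hbc : 0 < orient o a b c) (hcd : 0 < orient o a c d) : ∠ b a d = ∠ b a c + ∠ c a d := by
  have c_ne_a : c ≠ a := by rintro rfl; simp at hbc
  refine angle_eq_angle_add_add_angle_add_of_mem_span (sub_ne_zero.mpr c_ne_a) ?_
  simp only [orient_apply] at hbd hbc hcd
  have relation := areaForm_smul_add_smul_add_smul o (b - a) (c - a) (d - a)
  rw [o.areaForm_swap (d - a) (b - a)] at relation
  refine Submodule.mem_span_pair.mpr ⟨(ω (c - a) (d - a) / ω (b - a) (d - a)).toNNReal,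
    (ω (b - a) (c - a) / ω (b - a) (d - a)).toNNReal, ?_⟩
  rw [NNReal.smul_def, NNReal.smul_def, Real.coe_toNNReal _ (by positivity),
    Real.coe_toNNReal _ (by positivity), div_eq_inv_mul, div_eq_inv_mul, mul_smul, mul_smul,
    ← smul_add, inv_smul_eq_iff₀ hbd.ne', ← sub_eq_zero, ← relation]
  simp only [vsub_eq_sub]
  module

theorem IsConvexPolygon.ne_succ (hp : IsConvexPolygon o p) (hn : 2 < n) (i : Fin n) :
    p i ≠ p (i + 1) := fun h ↦ by
  simpa [h] using hp.orient_previous_pos hn i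

theorem IsConvexPolygon.areaForm_edgeDir_pos (hp : IsConvexPolygon o p) (hn : 2 < n) (i : Fin n) :
    0 < ω (edgeDir p i) (edgeDir p (i + 1)) := by
  have h := hp.orient_previous_pos hn (i + 1)
  rw [add_sub_cancel_right, orient_apply, ← sub_add_sub_cancel (p (i + 1 + 1)) (p (i + 1)),
    map_add, o.areaForm_apply_self, add_zero, ← dist_smul_edgeDir, ← dist_smul_edgeDir, map_smul,
    map_smul, LinearMap.smul_apply, smul_smul, smul_eq_mul] at h
  exact pos_of_mul_pos_right h (by positivity)

theorem IsConvexPolygon.areaForm_edgeDir (hp : IsConvexPolygon o p) (hn : 2 < n) (i : Fin n) :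
    ω (edgeDir p i) (edgeDir p (i + 1)) = Real.sin (turningAngle p i) := by
  have h := sin_angle_mul_norm_mul_norm_eq_abs_areaForm o (edgeDir p i) (edgeDir p (i + 1))
  rw [norm_edgeDir (hp.ne_succ hn i), norm_edgeDir (hp.ne_succ hn (i + 1)), mul_one, mul_one,
    abs_of_pos (hp.areaForm_edgeDir_pos hn i)] at h
  exact h.symm

theorem IsConvexPolygon.inner_edgeDir (hp : IsConvexPolygon o p) (hn : 2 < n) (i : Fin n) :
    ⟪edgeDir p i, edgeDir p (i + 1)⟫ = Real.cos (turningAngle p i) :=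
  inner_eq_cos_angle_of_norm_eq_one (norm_edgeDir (hp.ne_succ hn i))
    (norm_edgeDir (hp.ne_succ hn (i + 1)))

theorem IsConvexPolygon.sin_turningAngle_pos (hp : IsConvexPolygon o p) (hn : 2 < n) (i : Fin n) :
    0 < Real.sin (turningAngle p i) :=
  hp.areaForm_edgeDir hn i ▸ hp.areaForm_edgeDir_pos hn i

theorem IsConvexPolygon.turningAngle_mem_Ioo (hp : IsConvexPolygon o p) (hn : 2 < n) (i : Fin n) :
    turningAngle p i ∈ Ioo 0 π := by
  have sin_pos := hp.sin_turningAngle_pos hn i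
  refine ⟨(InnerProductGeometry.angle_nonneg _ _).lt_of_ne fun h ↦ ?_,
    (InnerProductGeometry.angle_le_pi _ _).lt_of_ne fun h ↦ ?_⟩
  · rw [turningAngle, ← h] at sin_pos; simp at sin_pos
  · rw [turningAngle, h] at sin_pos; simp at sin_pos

theorem IsConvexPolygon.areaForm_edgeDir_add_two (hp : IsConvexPolygon o p) (hn : 2 < n)
    (i : Fin n) : ω (edgeDir p i) (edgeDir p (i + 1 + 1)) =
      Real.sin (turningAngle p i + turningAngle p (i + 1)) := by
  have h := o.inner_mul_areaForm_sub (edgeDir p (i + 1)) (edgeDir p i) (edgeDir p (i + 1 + 1))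
  rw [norm_edgeDir (hp.ne_succ hn _), real_inner_comm, o.areaForm_swap _ (edgeDir p i),
    hp.areaForm_edgeDir hn, hp.areaForm_edgeDir hn, hp.inner_edgeDir hn, hp.inner_edgeDir hn] at h
  rw [Real.sin_add]
  linarith

end TurningAngle

section PentagonAngles

variable {E : Type*} [NormedAddCommGroup E] [InnerProductSpace ℝ E] [Fact (finrank ℝ E = 2)]
  {o : Orientation ℝ E (Fin 2)} {p : Fin 5 → E}

theorem IsConvexPolygon.orient_pos_of_cyclic (hp : IsConvexPolygon o p) {i j k : Fin 5}
    (hij : 0 < j - i) (hjk : j - i < k - i) : 0 < orient o (p i) (p j) (p k) := by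
  obtain rfl | rfl | rfl : j = i + 1 ∨ k = j + 1 ∨ i = k + 1 := by omega
  · exact hp i k (by omega) (by omega)
  · rw [← orient_rotate]; exact hp j i (by omega) (by omega)
  · rw [orient_rotate]; exact hp k j (by omega) (by omega)

theorem IsConvexPolygon.angle_add_angle_of_cyclic (hp : IsConvexPolygon o p) {a b c d : Fin 5}
    (hb : 0 < b - a) (hc : b - a < c - a) (hd : c - a < d - a) :
    ∠ (p b) (p a) (p d) = ∠ (p b) (p a) (p c) + ∠ (p c) (p a) (p d) :=
  angle_add_angle_of_orient_pos (hp.orient_pos_of_cyclic hb (hc.trans hd))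
    (hp.orient_pos_of_cyclic hb hc) (hp.orient_pos_of_cyclic (hb.trans hc) hd)

theorem IsConvexPolygon.injective (hp : IsConvexPolygon o p) : Function.Injective p := by
  intro i j h
  by_contra hij
  obtain ⟨k, hk⟩ : ∃ k : Fin 5, (0 < k - i ∧ k - i < j - i) ∨ (0 < k - j ∧ k - j < i - j) := by
    by_cases j - i = 1
    · exact ⟨j + 1, by omega⟩
    · exact ⟨i + 1, by omega⟩
  rcases hk with ⟨h₁, h₂⟩ | ⟨h₁, h₂⟩ <;> simpa [h] using hp.orient_pos_of_cyclic h₁ h₂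

theorem IsConvexPolygon.sum_turningAngle (hp : IsConvexPolygon o p) :
    ∑ i, turningAngle p i = 2 * π := by
  have turning {i j k : Fin 5} (hj : i + 1 = j) (hk : j + 1 = k) :
      turningAngle p i = π - ∠ (p k) (p j) (p i) := by
    subst hj hk
    rw [angle_comm, angle_eq_pi_sub_turningAngle, sub_sub_cancel]
  have triangle {i j : Fin 5} (h : i ≠ j) (k : Fin 5) :
      ∠ (p j) (p i) (p k) + ∠ (p i) (p k) (p j) + ∠ (p k) (p j) (p i) = π :=
    angle_add_angle_add_angle_eq_pi (p k) (hp.injective.ne h)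
  have angle_zero : ∠ (p 1) (p 0) (p 4) = ∠ (p 1) (p 0) (p 2) + ∠ (p 2) (p 0) (p 4) :=
    hp.angle_add_angle_of_cyclic (by decide) (by decide) (by decide)
  have angle_zero' : ∠ (p 2) (p 0) (p 4) = ∠ (p 2) (p 0) (p 3) + ∠ (p 3) (p 0) (p 4) :=
    hp.angle_add_angle_of_cyclic (by decide) (by decide) (by decide)
  have angle_two : ∠ (p 3) (p 2) (p 1) = ∠ (p 3) (p 2) (p 0) + ∠ (p 0) (p 2) (p 1) :=
    hp.angle_add_angle_of_cyclic (by decide) (by decide) (by decide)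
  have angle_three : ∠ (p 4) (p 3) (p 2) = ∠ (p 4) (p 3) (p 0) + ∠ (p 0) (p 3) (p 2) :=
    hp.angle_add_angle_of_cyclic (by decide) (by decide) (by decide)
  rw [Fin.sum_univ_five, turning (i := 0) (j := 1) (k := 2) rfl rfl,
    turning (i := 1) (j := 2) (k := 3) rfl rfl, turning (i := 2) (j := 3) (k := 4) rfl rfl,
    turning (i := 3) (j := 4) (k := 0) rfl rfl, turning (i := 4) (j := 0) (k := 1) rfl rfl]
  linarith [triangle (i := 1) (j := 2) (by decide) 0, triangle (i := 2) (j := 3) (by decide) 0,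
    triangle (i := 3) (j := 4) (by decide) 0]

end PentagonAngles

section Lhuilier

variable {E : Type*} [NormedAddCommGroup E] [InnerProductSpace ℝ E] [Fact (finrank ℝ E = 2)]
  (o : Orientation ℝ E (Fin 2)) {n : ℕ} [NeZero n] {p : Fin n → E}

local notation "ω" => o.areaForm

theorem inner_mul_areaForm_left {e : E} (he : ‖e‖ = 1) (e' y : E) :
    ⟪y, e⟫ * ω e e' = ω y e' - ⟪e, e'⟫ * ω y e := by
  have h := o.inner_mul_areaForm_sub e y e'
  rw [real_inner_comm, o.areaForm_swap e y, he] at h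
  linarith

theorem inner_mul_areaForm_right {e' : E} (he' : ‖e'‖ = 1) (e y : E) :
    ⟪y, e'⟫ * ω e e' = ⟪e, e'⟫ * ω y e' - ω y e := by
  have h := o.inner_mul_areaForm_sub e' y e
  rw [real_inner_comm, real_inner_comm e e', o.areaForm_swap e' y, o.areaForm_swap e' e, he'] at h
  linarith

/-- The signed distance from `q` to the line through the `i`-th edge of `p`, positive on the
left. -/
noncomputable def edgeDist (p : Fin n → E) (q : E) (i : Fin n) : ℝ := ω (p i - q) (edgeDir p i)

theorem areaForm_succ_sub_edgeDir (p : Fin n → E) (q : E) (i : Fin n) :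
    ω (p (i + 1) - q) (edgeDir p i) = edgeDist o p q i := by
  rw [← sub_add_sub_cancel _ (p i), ← dist_smul_edgeDir, map_add, map_smul, LinearMap.add_apply,
    LinearMap.smul_apply, o.areaForm_apply_self, smul_zero, zero_add, edgeDist]

theorem orient_eq_dist_mul_edgeDist (p : Fin n → E) (q : E) (i : Fin n) :
    orient o q (p i) (p (i + 1)) = dist (p i) (p (i + 1)) * edgeDist o p q i := by
  rw [orient_apply, ← sub_add_sub_cancel (p (i + 1)) (p i), map_add, o.areaForm_apply_self,
    add_zero, ← dist_smul_edgeDir, map_smul, smul_eq_mul, edgeDist]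

/- If a circle of radius `r` about `q` touches all the edges, the right hand side vanishes and the
identity reads `area = r * perimeter - r ^ 2 * ∑ tan (τ i / 2)`. The proof expresses the length of
each edge by the feet of the perpendiculars from `q` and collects the two terms at each vertex. -/
theorem lhuilier_identity (hp : ∀ i, p i ≠ p (i + 1))
    (hω : ∀ i, ω (edgeDir p i) (edgeDir p (i + 1)) ≠ 0) (q : E) (r : ℝ) :
    2 * signedArea o p - 2 * r * ∑ i, dist (p i) (p (i + 1)) + 2 * r ^ 2 *
        ∑ i, (1 - ⟪edgeDir p i, edgeDir p (i + 1)⟫) / ω (edgeDir p i) (edgeDir p (i + 1)) =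
      ∑ i, (2 * (edgeDist o p q i - r) * (edgeDist o p q (i + 1) - r) -
        ⟪edgeDir p i, edgeDir p (i + 1)⟫ *
          ((edgeDist o p q i - r) ^ 2 + (edgeDist o p q (i + 1) - r) ^ 2)) /
          ω (edgeDir p i) (edgeDir p (i + 1)) := by
  let e := edgeDir p
  let d := edgeDist o p q
  have collect : ∑ i, dist (p i) (p (i + 1)) * (d i - 2 * r) =
      ∑ i, (⟪p (i + 1) - q, e i⟫ * (d i - 2 * r) -
        ⟪p (i + 1) - q, e (i + 1)⟫ * (d (i + 1) - 2 * r)) := by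
    have shift : ∑ i, ⟪p (i + 1) - q, e (i + 1)⟫ * (d (i + 1) - 2 * r) =
        ∑ i, ⟪p i - q, e i⟫ * (d i - 2 * r) :=
      Equiv.sum_comp (Equiv.addRight 1) fun i ↦ ⟪p i - q, e i⟫ * (d i - 2 * r)
    rw [Finset.sum_sub_distrib, shift, ← Finset.sum_sub_distrib]
    exact Finset.sum_congr rfl fun i _ ↦ by rw [dist_eq_inner_sub_inner (hp i) q, sub_mul]
  have vertex (i : Fin n) : ⟪p (i + 1) - q, e i⟫ * (d i - 2 * r) -
      ⟪p (i + 1) - q, e (i + 1)⟫ * (d (i + 1) - 2 * r) +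
        2 * r ^ 2 * ((1 - ⟪e i, e (i + 1)⟫) / ω (e i) (e (i + 1))) =
      (2 * (d i - r) * (d (i + 1) - r) - ⟪e i, e (i + 1)⟫ * ((d i - r) ^ 2 + (d (i + 1) - r) ^ 2)) /
        ω (e i) (e (i + 1)) := by
    have hleft := inner_mul_areaForm_left o (norm_edgeDir (hp i)) (e (i + 1)) (p (i + 1) - q)
    have hright := inner_mul_areaForm_right o (norm_edgeDir (hp (i + 1))) (e i) (p (i + 1) - q)
    rw [areaForm_succ_sub_edgeDir] at hleft hright
    change _ = d (i + 1) - _ * d i at hleft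
    change _ = _ * d (i + 1) - d i at hright
    rw [← mul_div_assoc, eq_div_iff (hω i), add_mul, div_mul_cancel₀ _ (hω i)]
    linear_combination (d i - 2 * r) * hleft - (d (i + 1) - 2 * r) * hright
  rw [← sum_orient_eq o p q, ← Finset.sum_congr rfl fun i _ ↦ vertex i, Finset.sum_add_distrib,
    ← collect, Finset.mul_sum, Finset.mul_sum, ← Finset.sum_sub_distrib]
  congr 1
  exact Finset.sum_congr rfl fun i _ ↦ by rw [orient_eq_dist_mul_edgeDist]; ring

theorem tan_half_eq {x : ℝ} (hx : Real.sin x ≠ 0) :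
    Real.tan (x / 2) = (1 - Real.cos x) / Real.sin x := by
  obtain ⟨y, rfl⟩ : ∃ y, x = 2 * y := ⟨x / 2, by ring⟩
  rw [Real.sin_two_mul] at hx ⊢
  have hcos : Real.cos y ≠ 0 := right_ne_zero_of_mul hx
  have hsin : Real.sin y ≠ 0 := right_ne_zero_of_mul (left_ne_zero_of_mul hx)
  rw [Real.cos_two_mul, Real.cos_sq', mul_div_cancel_left₀ _ two_ne_zero, Real.tan_eq_sin_div_cos]
  field

variable {o}

theorem IsConvexPolygon.lhuilier (hp : IsConvexPolygon o p) (hn : 2 < n) (q : E) (r : ℝ) :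
    2 * signedArea o p - 2 * r * ∑ i, dist (p i) (p (i + 1)) +
        2 * r ^ 2 * ∑ i, Real.tan (turningAngle p i / 2) =
      ∑ i, (2 * (edgeDist o p q i - r) * (edgeDist o p q (i + 1) - r) -
        Real.cos (turningAngle p i) *
          ((edgeDist o p q i - r) ^ 2 + (edgeDist o p q (i + 1) - r) ^ 2)) /
          Real.sin (turningAngle p i) := by
  have h := lhuilier_identity o (hp.ne_succ hn) (fun i ↦ (hp.areaForm_edgeDir_pos hn i).ne') q r
  simp only [hp.areaForm_edgeDir hn, hp.inner_edgeDir hn] at h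
  simpa only [tan_half_eq (hp.sin_turningAngle_pos hn _).ne'] using h

end Lhuilier

section PentagonInequality

variable {E : Type*} [NormedAddCommGroup E] [InnerProductSpace ℝ E] [Fact (finrank ℝ E = 2)]
  {o : Orientation ℝ E (Fin 2)} {p : Fin 5 → E}

theorem exists_add_le_of_sum_eq_two_mul {t : Fin 5 → ℝ} {s : ℝ} (ht : ∀ i, 0 ≤ t i)
    (hsum : ∑ i, t i = 2 * s) : ∃ j, t j + t (j + 1) ≤ s ∧ t (j + 2) + t (j + 3) ≤ s := by
  by_contra! h
  rw [Fin.sum_univ_five] at hsum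
  have h₀ := h 0; have h₁ := h 1; have h₂ := h 2; have h₃ := h 3; have h₄ := h 4
  simp only [Fin.reduceAdd, zero_add] at h₀ h₁ h₂ h₃ h₄
  grind

variable (o) in
theorem exists_areaForm_add_eq {e₀ e₁ e₂ : E}
    (he : o.areaForm e₀ e₁ + o.areaForm e₁ e₂ + o.areaForm e₂ e₀ ≠ 0) (h₀ h₁ h₂ : ℝ) :
    ∃ (z : E) (r : ℝ), o.areaForm z e₀ + r = h₀ ∧ o.areaForm z e₁ + r = h₁ ∧
      o.areaForm z e₂ + r = h₂ := by
  set D := o.areaForm e₀ e₁ + o.areaForm e₁ e₂ + o.areaForm e₂ e₀ with hD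
  refine ⟨D⁻¹ • (h₀ • (e₂ - e₁) + h₁ • (e₀ - e₂) + h₂ • (e₁ - e₀)),
    D⁻¹ * (h₀ * o.areaForm e₁ e₂ + h₁ * o.areaForm e₂ e₀ + h₂ * o.areaForm e₀ e₁), ?_, ?_, ?_⟩ <;>
  · simp only [map_smul, map_add, map_sub, LinearMap.smul_apply, LinearMap.add_apply,
      LinearMap.sub_apply, o.areaForm_apply_self, o.areaForm_swap e₁ e₀, o.areaForm_swap e₂ e₁,
      o.areaForm_swap e₀ e₂, smul_eq_mul]
    rw [← mul_add, inv_mul_eq_iff_eq_mul₀ he, hD]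
    ring

theorem cot_add_cot_nonneg {x y : ℝ} (hx : 0 < Real.sin x) (hy : 0 < Real.sin y)
    (hxy : 0 ≤ Real.sin (x + y)) : 0 ≤ Real.cos x / Real.sin x + Real.cos y / Real.sin y := by
  have : Real.cos x / Real.sin x + Real.cos y / Real.sin y =
      Real.sin (x + y) / (Real.sin x * Real.sin y) := by
    rw [Real.sin_add]; field
  rw [this]
  positivity

theorem IsConvexPolygon.sin_turningAngle_add_nonneg (hp : IsConvexPolygon o p) {i j : Fin 5}
    (h : turningAngle p i + turningAngle p j ≤ π) :
    0 ≤ Real.sin (turningAngle p i + turningAngle p j) :=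
  Real.sin_nonneg_of_nonneg_of_le_pi (add_nonneg (hp.turningAngle_mem_Ioo (by simp) i).1.le
    (hp.turningAngle_mem_Ioo (by simp) j).1.le) h

theorem IsConvexPolygon.exists_edgeDist_eq (hp : IsConvexPolygon o p) {j : Fin 5}
    (h₁ : turningAngle p j + turningAngle p (j + 1) ≤ π)
    (h₂ : turningAngle p (j + 2) + turningAngle p (j + 3) ≤ π) :
    ∃ (q : E) (r : ℝ), edgeDist o p q j = r ∧ edgeDist o p q (j + 2) = r ∧
      edgeDist o p q (j + 4) = r := by
  have hn : 2 < 5 := by norm_num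
  have areaForm_first := hp.areaForm_edgeDir_add_two hn j
  have areaForm_second := hp.areaForm_edgeDir_add_two hn (j + 2)
  have areaForm_third := hp.areaForm_edgeDir_pos hn (j + 4)
  simp only [add_assoc, Fin.reduceAdd, add_zero] at areaForm_first areaForm_second areaForm_third
  have sum_pos : 0 < o.areaForm (edgeDir p j) (edgeDir p (j + 2)) +
      o.areaForm (edgeDir p (j + 2)) (edgeDir p (j + 4)) +
      o.areaForm (edgeDir p (j + 4)) (edgeDir p j) := by
    rw [areaForm_first, areaForm_second]
    linarith [hp.sin_turningAngle_add_nonneg h₁, hp.sin_turningAngle_add_nonneg h₂]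
  obtain ⟨q, r, hq₀, hq₂, hq₄⟩ := exists_areaForm_add_eq o sum_pos.ne'
    (o.areaForm (p j) (edgeDir p j)) (o.areaForm (p (j + 2)) (edgeDir p (j + 2)))
    (o.areaForm (p (j + 4)) (edgeDir p (j + 4)))
  refine ⟨q, r, ?_⟩
  simp only [edgeDist, map_sub, LinearMap.sub_apply]
  exact ⟨by linarith, by linarith, by linarith⟩

theorem IsConvexPolygon.four_mul_signedArea_mul_sum_tan_le (hp : IsConvexPolygon o p) :
    4 * signedArea o p * ∑ i, Real.tan (turningAngle p i / 2) ≤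
      (∑ i, dist (p i) (p (i + 1))) ^ 2 := by
  have hn : 2 < 5 := by norm_num
  have turning_pos (i : Fin 5) := (hp.turningAngle_mem_Ioo hn i).1
  have sin_pos := hp.sin_turningAngle_pos hn
  have sum_tan_nonneg : 0 ≤ ∑ i, Real.tan (turningAngle p i / 2) := Finset.sum_nonneg fun i _ ↦
    Real.tan_nonneg_of_nonneg_of_le_pi_div_two (by linarith [turning_pos i])
      (by linarith [(hp.turningAngle_mem_Ioo hn i).2])
  obtain ⟨j, h₁, h₂⟩ := exists_add_le_of_sum_eq_two_mul (fun i ↦ (turning_pos i).le)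
    hp.sum_turningAngle
  obtain ⟨q, r, hq₀, hq₂, hq₄⟩ := hp.exists_edgeDist_eq h₁ h₂
  have cot₁ := cot_add_cot_nonneg (sin_pos j) (sin_pos (j + 1))
    (hp.sin_turningAngle_add_nonneg h₁)
  have cot₂ := cot_add_cot_nonneg (sin_pos (j + 2)) (sin_pos (j + 3))
    (hp.sin_turningAngle_add_nonneg h₂)
  have lhuilier := hp.lhuilier hn q r
  have rhs_nonpos : 2 * signedArea o p - 2 * r * ∑ i, dist (p i) (p (i + 1)) +
      2 * r ^ 2 * ∑ i, Real.tan (turningAngle p i / 2) ≤ 0 := by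
    rw [lhuilier, ← Equiv.sum_comp (Equiv.addLeft j), Fin.sum_univ_five]
    simp only [Equiv.coe_addLeft, add_assoc, Fin.reduceAdd, add_zero, hq₀, hq₂, hq₄, sub_self]
    have term₁ := mul_nonneg cot₁ (sq_nonneg (edgeDist o p q (j + 1) - r))
    have term₂ := mul_nonneg cot₂ (sq_nonneg (edgeDist o p q (j + 3) - r))
    ring_nf at term₁ term₂ ⊢
    linarith
  have := sq_nonneg (∑ i, dist (p i) (p (i + 1)) -
    2 * r * ∑ i, Real.tan (turningAngle p i / 2))
  nlinarith [mul_nonneg (neg_nonneg.mpr rhs_nonpos) sum_tan_nonneg]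

end PentagonInequality

section Convexity

theorem tangent_line_le {s : Set ℝ} {f : ℝ → ℝ} (hf : ConvexOn ℝ s f) {x y f' : ℝ} (hx : x ∈ s)
    (hy : y ∈ s) (hf' : HasDerivAt f f' x) : f x + f' * (y - x) ≤ f y := by
  rcases lt_trichotomy x y with hxy | rfl | hyx
  · have := hf.le_slope_of_hasDerivAt hx hy hxy hf'
    rw [slope_def_field, le_div_iff₀ (sub_pos.2 hxy)] at this
    linarith
  · simp
  · have := hf.slope_le_of_hasDerivAt hy hx hyx hf'
    rw [slope_def_field, div_le_iff₀ (sub_pos.2 hyx)] at this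
    linarith

-- Jensen's inequality with one variable kept away from the mean: add up the tangent line at `x`,
-- taken at `b i`, and the tangent lines at `y`, taken at the other variables.
theorem add_card_sub_one_mul_le_sum_of_convexOn {ι : Type*} [Fintype ι] {s : Set ℝ} {f : ℝ → ℝ}
    (hf : ConvexOn ℝ s f) (hd : ∀ z ∈ s, DifferentiableAt ℝ f z) {b : ι → ℝ} (hb : ∀ j, b j ∈ s)
    {x y : ℝ} (hx : x ∈ s) (hy : y ∈ s) (hsum : ∑ j, b j = x + (Fintype.card ι - 1) * y) {i : ι}
    (hi : x ∈ uIcc (b i) y) : f x + (Fintype.card ι - 1) * f y ≤ ∑ j, f (b j) := by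
  classical
  have deriv_diff : 0 ≤ (b i - x) * (deriv f x - deriv f y) := by
    have hmono := hf.monotoneOn_deriv hd
    rcases mem_uIcc.1 hi with ⟨hbx, hxy⟩ | ⟨hyx, hxb⟩
    · exact mul_nonneg_of_nonpos_of_nonpos (sub_nonpos.2 hbx) (sub_nonpos.2 (hmono hx hy hxy))
    · exact mul_nonneg (sub_nonneg.2 hxb) (sub_nonneg.2 (hmono hy hx hyx))
  have tangents : ∑ j ∈ Finset.univ.erase i, (f y + deriv f y * (b j - y)) ≤
      ∑ j ∈ Finset.univ.erase i, f (b j) :=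
    Finset.sum_le_sum fun j _ ↦ tangent_line_le hf hy (hb j) (hd y hy).hasDerivAt
  have tangent := tangent_line_le hf hx (hb i) (hd x hx).hasDerivAt
  have hcard : ((Finset.univ.erase i).card : ℝ) = Fintype.card ι - 1 := by
    rw [Finset.card_erase_of_mem (Finset.mem_univ i), Finset.card_univ,
      Nat.cast_pred (Fintype.card_pos_iff.2 ⟨i⟩)]
  rw [← Finset.add_sum_erase _ _ (Finset.mem_univ i)] at hsum ⊢
  simp only [Finset.sum_add_distrib, ← Finset.mul_sum, Finset.sum_sub_distrib, Finset.sum_const,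
    nsmul_eq_mul, hcard] at tangents
  linear_combination tangents + tangent + deriv_diff - deriv f y * hsum

theorem convexOn_tan : ConvexOn ℝ (Ico 0 (π / 2)) Real.tan := by
  have hcos : ∀ x ∈ Ico 0 (π / 2), 0 < Real.cos x := fun x hx ↦
    Real.cos_pos_of_mem_Ioo ⟨by linarith [hx.1, Real.pi_pos], hx.2⟩
  refine MonotoneOn.convexOn_of_deriv (convex_Ico _ _)
    (fun x hx ↦ (Real.continuousAt_tan.2 (hcos x hx).ne').continuousWithinAt) ?_ ?_
  · exact fun x hx ↦ (Real.differentiableAt_tan.2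
      (hcos x (interior_subset hx)).ne').differentiableWithinAt
  · intro x hx y hy hxy
    replace hx := interior_subset hx
    replace hy := interior_subset hy
    rw [Real.deriv_tan, Real.deriv_tan]
    have := hcos y hy
    have := Real.cos_le_cos_of_nonneg_of_le_pi hx.1 (by linarith [hy.2, Real.pi_pos]) hxy
    gcongr

end Convexity

section HalfAngles

theorem sub_le_arctan {x : ℝ} (hx : 0 ≤ x) : x - x ^ 3 / 3 ≤ Real.arctan x := by
  have hderiv (y : ℝ) : HasDerivAt (fun y ↦ Real.arctan y - (y - y ^ 3 / 3))
      (y ^ 4 / (1 + y ^ 2)) y := by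
    refine ((Real.hasDerivAt_arctan y).sub
      ((hasDerivAt_id y).sub ((hasDerivAt_pow 3 y).div_const 3))).congr_deriv ?_
    field_simp
    ring
  simpa using monotone_of_hasDerivAt_nonneg hderiv (fun y ↦ by positivity) hx

theorem arctan_le_add {x : ℝ} (hx : 0 ≤ x) : Real.arctan x ≤ x - x ^ 3 / 3 + x ^ 5 / 5 := by
  have hderiv (y : ℝ) : HasDerivAt (fun y ↦ y - y ^ 3 / 3 + y ^ 5 / 5 - Real.arctan y)
      (y ^ 6 / (1 + y ^ 2)) y := by
    refine ((((hasDerivAt_id y).sub ((hasDerivAt_pow 3 y).div_const 3)).add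
      ((hasDerivAt_pow 5 y).div_const 5)).sub (Real.hasDerivAt_arctan y)).congr_deriv ?_
    field_simp
    ring
  simpa using monotone_of_hasDerivAt_nonneg hderiv (fun y ↦ by positivity) hx

theorem tan_four_mul_arctan (t : ℝ) : Real.tan (4 * Real.arctan t) =
    2 * (2 * t / (1 - t ^ 2)) / (1 - (2 * t / (1 - t ^ 2)) ^ 2) := by
  rw [show 4 * Real.arctan t = 2 * (2 * Real.arctan t) by ring, Real.tan_two_mul,
    Real.tan_two_mul, Real.tan_arctan]

theorem tan_pi_div_four_sub_arctan {t : ℝ} (ht : -1 < t) :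
    Real.tan (π / 4 - Real.arctan t) = (1 - t) / (1 + t) := by
  have hlt : t * ((1 - t) / (1 + t)) < 1 := by
    rw [← mul_div_assoc, div_lt_one (by linarith)]
    nlinarith [sq_nonneg t]
  have hquot : (t + (1 - t) / (1 + t)) / (1 - t * ((1 - t) / (1 + t))) = 1 := by
    rw [div_eq_one_iff_eq (sub_pos.2 hlt).ne']
    have : 0 < 1 + t := by linarith
    field_simp
    ring
  have hadd := Real.arctan_add hlt
  rw [hquot, Real.arctan_one] at hadd
  rw [← hadd, add_sub_cancel_left, Real.tan_arctan]

variable {b : Fin 5 → ℝ} (hb : ∀ i, b i ∈ Ioo 0 (π / 2)) (hsum : ∑ i, b i = π)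
include hb hsum

theorem le_sum_tan {θ : ℝ} (hθ₀ : 0 ≤ θ) (hθ₁ : θ < π / 8) {i : Fin 5}
    (hi : 4 * θ ∈ uIcc (b i) (π / 4 - θ)) :
    Real.tan (4 * θ) + 4 * Real.tan (π / 4 - θ) ≤ ∑ i, Real.tan (b i) := by
  have hcard : (Fintype.card (Fin 5) : ℝ) - 1 = 4 := by norm_num
  have hd : ∀ x ∈ Ico 0 (π / 2), DifferentiableAt ℝ Real.tan x := fun x hx ↦
    Real.differentiableAt_tan.2
      (Real.cos_pos_of_mem_Ioo ⟨by linarith [hx.1, Real.pi_pos], hx.2⟩).ne'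
  have := add_card_sub_one_mul_le_sum_of_convexOn convexOn_tan hd
    (fun j ↦ Ioo_subset_Ico_self (hb j)) ⟨by linarith, by linarith⟩ ⟨by linarith, by linarith⟩
    (by rw [hsum, hcard]; ring) hi
  rwa [hcard] at this

variable (htan : ∑ i, Real.tan (b i) ≤ 2 + √3) (i : Fin 5)
include htan

-- `4123 / 50000` is slightly larger than `tan (18.855° / 4)`.
theorem lt_apply_of_sum_tan_le : 18.855 * (π / 180) < b i := by
  have hsqrt : √3 < 1.7320509 := (Real.sqrt_lt' (by norm_num)).2 (by norm_num)
  have hpi := Real.pi_gt_d6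
  have hpi' := Real.pi_lt_d6
  have harctan := sub_le_arctan (x := 4123 / 50000) (by norm_num)
  have harctan' := arctan_le_add (x := 4123 / 50000) (by norm_num)
  by_contra! hbi
  norm_num at hsqrt hpi hpi' harctan harctan' hbi
  have hfar : b i ≤ 4 * Real.arctan (4123 / 50000) := by linarith
  have hnear : 4 * Real.arctan (4123 / 50000) ≤ π / 4 - Real.arctan (4123 / 50000) := by linarith
  have := le_sum_tan hb hsum (Real.arctan_nonneg.2 (by norm_num)) (by linarith)
    (mem_uIcc_of_le hfar hnear)
  rw [tan_four_mul_arctan, tan_pi_div_four_sub_arctan (by norm_num)] at this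
  norm_num at this
  linarith only [this, htan, hsqrt]

-- `549 / 2500` is slightly smaller than `tan (49.545° / 4)`.
theorem apply_lt_of_sum_tan_le : b i < 49.545 * (π / 180) := by
  have hsqrt : √3 < 1.7320509 := (Real.sqrt_lt' (by norm_num)).2 (by norm_num)
  have hpi := Real.pi_gt_d6
  have hpi' := Real.pi_lt_d6
  have harctan := sub_le_arctan (x := 549 / 2500) (by norm_num)
  have harctan' := arctan_le_add (x := 549 / 2500) (by norm_num)
  by_contra! hbi
  norm_num at hsqrt hpi hpi' harctan harctan' hbi
  have hfar : 4 * Real.arctan (549 / 2500) ≤ b i := by linarith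
  have hnear : π / 4 - Real.arctan (549 / 2500) ≤ 4 * Real.arctan (549 / 2500) := by linarith
  have := le_sum_tan hb hsum (Real.arctan_nonneg.2 (by norm_num)) (by linarith)
    (mem_uIcc_of_ge hnear hfar)
  rw [tan_four_mul_arctan, tan_pi_div_four_sub_arctan (by norm_num)] at this
  norm_num at this
  linarith only [this, htan, hsqrt]

end HalfAngles

section Plane

local notation "𝔼²" => EuclideanSpace ℝ (Fin 2)

local instance : Fact (finrank ℝ 𝔼² = 2) := ⟨finrank_euclideanSpace_fin⟩

section Region

variable {n : ℕ} [NeZero n] {p : Polygon 𝔼² n} {o : Orientation ℝ 𝔼² (Fin 2)}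

theorem edgeSet_eq_segment (p : Polygon 𝔼² n) (i : Fin n) :
    p.edgeSet ℝ i = segment ℝ (p i) (p (i + 1)) := by
  rw [← affineSegment_eq_segment, Polygon.edgeSet, finRotate_apply]

theorem boundary_eq_iUnion_segment (p : Polygon 𝔼² n) :
    p.boundary ℝ = ⋃ i, segment ℝ (p i) (p (i + 1)) :=
  iUnion_congr fun i ↦ edgeSet_eq_segment p i

theorem enclosedRegion_subset_convexHull (p : Polygon 𝔼² n) :
    p.enclosedRegion ⊆ convexHull ℝ (range p) := by
  rintro x ⟨-, hx⟩
  by_contra hx_notMem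
  refine not_isBounded_connectedComponentIn_compl (convex_convexHull ℝ (range p))
    (range_nonempty p).convexHull ?_ hx_notMem hx
  rw [boundary_eq_iUnion_segment]
  exact iUnion_subset fun i ↦ segment_subset_convexHull (mem_range_self _) (mem_range_self _)

theorem IsConvexPolygon.innerRegion_subset_enclosedRegion (hp : IsConvexPolygon o p) (hn : 2 < n) :
    innerRegion o p ⊆ p.enclosedRegion := fun x hx ↦ by
  refine ⟨fun hx_boundary ↦ ?_, ?_⟩
  · rw [boundary_eq_iUnion_segment] at hx_boundary
    obtain ⟨i, hi⟩ := mem_iUnion.mp hx_boundary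
    exact (disjoint_innerRegion_segment i).notMem_of_mem_left hx hi
  · refine (hp.isBounded_innerRegion hn).subset
      (connectedComponentIn_compl_subset isOpen_innerRegion ?_ hx)
    rw [boundary_eq_iUnion_segment]
    exact hp.frontier_innerRegion_subset hn

theorem IsConvexPolygon.interiorAngle_eq (hp : IsConvexPolygon o p) (hn : 2 < n) (i : Fin n) :
    p.interiorAngle i = EuclideanGeometry.angle (p (i - 1)) (p i) (p (i + 1)) := by
  rw [Polygon.interiorAngle, finRotate_apply, finRotate_symm_apply, if_pos]
  filter_upwards [Ioo_mem_nhdsGT one_pos] with t ht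
  exact hp.innerRegion_subset_enclosedRegion hn (hp.lineMap_midpoint_mem_innerRegion hn i ht)

theorem IsConvexPolygon.interiorAngle_eq_pi_sub (hp : IsConvexPolygon o p) (hn : 2 < n)
    (i : Fin n) : p.interiorAngle (i + 1) = π - turningAngle p i := by
  rw [hp.interiorAngle_eq hn, add_sub_cancel_right, angle_eq_pi_sub_turningAngle]

theorem perimeter_eq_sum_dist (p : Polygon 𝔼² n) : p.perimeter = ∑ i, dist (p i) (p (i + 1)) := by
  simp only [Polygon.perimeter, finRotate_apply]

theorem area_le_volume_convexHull (p : Polygon 𝔼² n) :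
    p.area ≤ volume (convexHull ℝ (range p)) :=
  measure_mono (enclosedRegion_subset_convexHull p)

end Region

theorem sum_dist_succAbove_le {X : Type*} [PseudoMetricSpace X] (p : Fin 5 → X) (i : Fin 5) :
    ∑ j, dist (p (i.succAbove j)) (p (i.succAbove (j + 1))) ≤ ∑ j, dist (p j) (p (j + 1)) := by
  have := dist_triangle (p (i + 4)) (p i) (p (i + 1))
  simp only [Fin.sum_univ_four, Fin.sum_univ_five, Fin.reduceAdd, zero_add]
  fin_cases i <;> simp [Fin.succAbove] at this ⊢ <;> linarith

theorem area_le_of_mem_convexHull {p : Polygon 𝔼² 5} {i : Fin 5}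
    (hi : p i ∈ convexHull ℝ (p '' {i}ᶜ)) : p.area ≤ ENNReal.ofReal (p.perimeter ^ 2 / 16) := by
  have hull_eq : convexHull ℝ (range p) = convexHull ℝ (range fun j ↦ p (i.succAbove j)) := by
    rw [← Function.comp_def p, range_comp p i.succAbove, Fin.range_succAbove]
    refine (convexHull_min (range_subset_iff.2 fun j ↦ ?_) (convex_convexHull ℝ _)).antisymm
      (convexHull_mono (image_subset_range _ _))
    rcases eq_or_ne j i with rfl | hji
    · exact hi
    · exact subset_convexHull ℝ _ (mem_image_of_mem p hji)
  calc p.area ≤ volume (convexHull ℝ (range p)) := area_le_volume_convexHull p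
    _ ≤ ENNReal.ofReal ((∑ j, dist (p (i.succAbove j)) (p (i.succAbove (j + 1)))) ^ 2 / 16) :=
      hull_eq ▸ volume_convexHull_range_four_le _
    _ ≤ ENNReal.ofReal (p.perimeter ^ 2 / 16) := by
      rw [perimeter_eq_sum_dist]
      have := sum_dist_succAbove_le p i
      gcongr

section Efficient

variable {p : Polygon 𝔼² 5} (hp : p.IsEfficient)
include hp

theorem perimeter_sq_le : p.perimeter ^ 2 ≤ 4 * (2 + √3) :=
  calc p.perimeter ^ 2 ≤ (2 * √(2 + √3)) ^ 2 := by
        have : 0 ≤ p.perimeter := Finset.sum_nonneg fun i _ ↦ dist_nonneg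
        have := hp.perimeter_le
        gcongr
    _ = 4 * (2 + √3) := by rw [mul_pow, Real.sq_sqrt (by positivity)]; norm_num

theorem notMem_convexHull_image_compl (i : Fin 5) : p i ∉ convexHull ℝ (p '' {i}ᶜ) := by
  intro hi
  have hle := area_le_of_mem_convexHull hi
  rw [hp.area_eq_one, ENNReal.one_le_ofReal] at hle
  have hsqrt : √3 < 2 := (Real.sqrt_lt' (by norm_num)).2 (by norm_num)
  linarith [perimeter_sq_le hp]

theorem exists_isConvexPolygon_of_isEfficient : ∃ o, IsConvexPolygon o p := by
  refine exists_isConvexPolygon (notMem_convexHull_image_compl hp) fun i ↦ ?_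
  have hdisj := hp.isSimple.2.2 i (i + 2) (by simp) (by simp [finRotate_apply])
    (by rw [finRotate_apply, add_assoc]; simp)
  rwa [edgeSet_eq_segment, edgeSet_eq_segment, add_assoc] at hdisj

variable {o : Orientation ℝ 𝔼² (Fin 2)} (hconv : IsConvexPolygon o p)
include hconv

theorem one_le_signedArea : 1 ≤ signedArea o p := by
  rw [← ENNReal.one_le_ofReal, ← hp.area_eq_one]
  exact (area_le_volume_convexHull p).trans (hconv.volume_convexHull_le (by norm_num))

theorem sum_tan_turningAngle_le : ∑ i, Real.tan (turningAngle p i / 2) ≤ 2 + √3 := by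
  have hnonneg : 0 ≤ ∑ i, Real.tan (turningAngle p i / 2) := Finset.sum_nonneg fun i _ ↦ by
    obtain ⟨h₀, h₁⟩ := hconv.turningAngle_mem_Ioo (by norm_num) i
    exact Real.tan_nonneg_of_nonneg_of_le_pi_div_two (by linarith) (by linarith)
  have : 4 * ∑ i, Real.tan (turningAngle p i / 2) ≤ 4 * (2 + √3) := calc
    4 * ∑ i, Real.tan (turningAngle p i / 2)
      ≤ 4 * signedArea o p * ∑ i, Real.tan (turningAngle p i / 2) := by
        gcongr
        linarith [one_le_signedArea hp hconv]
    _ ≤ p.perimeter ^ 2 :=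
        perimeter_eq_sum_dist p ▸ hconv.four_mul_signedArea_mul_sum_tan_le
    _ ≤ 4 * (2 + √3) := perimeter_sq_le hp
  linarith

end Efficient

end Plane

end Pentagon

theorem proposition2p9 (p : Polygon (EuclideanSpace ℝ (Fin 2)) 5) (hp : p.IsEfficient)
    (i : Fin 5) :
    80.91 * (π / 180) < p.interiorAngle i ∧ p.interiorAngle i < 142.29 * (π / 180) := by
  have : Fact (Module.finrank ℝ (EuclideanSpace ℝ (Fin 2)) = 2) := ⟨finrank_euclideanSpace_fin⟩
  obtain ⟨o, hconv⟩ := Pentagon.exists_isConvexPolygon_of_isEfficient hp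
  have half_mem (i : Fin 5) : Pentagon.turningAngle p i / 2 ∈ Set.Ioo 0 (π / 2) := by
    obtain ⟨h₀, h₁⟩ := hconv.turningAngle_mem_Ioo (by norm_num) i
    constructor <;> linarith
  have half_sum : ∑ i, Pentagon.turningAngle p i / 2 = π := by
    rw [← Finset.sum_div, hconv.sum_turningAngle]
    ring
  have tan_sum := Pentagon.sum_tan_turningAngle_le hp hconv
  have angle_eq := hconv.interiorAngle_eq_pi_sub (by norm_num) (i - 1)
  rw [sub_add_cancel] at angle_eq
  constructor
  · linarith [Pentagon.apply_lt_of_sum_tan_le half_mem half_sum tan_sum (i - 1)]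
  · linarith [Pentagon.lt_apply_of_sum_tan_le half_mem half_sum tan_sum (i - 1)]
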